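/- Let $\mathbb{T}$ be the unit circle with normalised arc length, let $H^2\subset L^2(\mathbb{T})$ be the Hardy space of functions whose Fourier coefficients of negative index vanish, let $\mathbb{P}$ be the orthogonal (Riesz) projection of $L^2(\mathbb{T})$ onto $H^2$, and write $f(0)$ for the zeroth Fourier coefficient of $f\in H^2$. Let $T_z$ be multiplication by $z$ on $H^2$. Let $\mathrm{Rat}_0(\mathbb{T})$ be the set of strictly proper rational complex functions (including $0$) all of whose poles lie on $\mathbb{T}$. For a rational complex function $\omega$, possibly with poles on $\mathbb{T}$, let $T_\omega\,(H^2\to H^2)$ be the unbounded operator given by $$\mathrm{Dom}(T_\omega)=\{g\in H^2 : \omega g=f+\rho \text{ with } f\in L^2(\mathbb{T}),\ \rho\in \mathrm{Rat}_0(\mathbb{T})\},\qquad T_\omega g=\mathbb{P}f$$ (this is well defined, since $L^2(\mathbb{T})\cap\mathrm{Rat}_0(\mathbb{T})=\{0\}$). Proposition. For every rational complex function $\omega$, $T=T_\omega$ is a Sarason-Toeplitz operator on $H^2$; that is, $T$ is closed and densely defined, and 1. $T_z\,\mathrm{Dom}(T)\subset \mathrm{Dom}(T)$; 2. $T_z^*\,T\,T_z=T$,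 as unbounded operators (with equality of the domains, where $\mathrm{Dom}(T_z^*TT_z)=\{f\in H^2: T_zf\in\mathrm{Dom}(T)\}$); 3. if $f\in \mathrm{Dom}(T)$ and $f(0)=0$, then $T_z^*f\in\mathrm{Dom}(T)$. -/

import Mathlib

open MeasureTheory AddCircle

open scoped ENNReal InnerProduct

noncomputable section

/-- `L²(𝕋)`: the unit circle is parametrised by `ℝ/ℤ` through `x ↦ AddCircle.toCircle x = e^{2πix}`
and carries normalised arc length. -/
abbrev L2T : Type := Lp ℂ 2 (haarAddCircle : Measure UnitAddCircle)

/-- The Hardy space `H²`: the functions in `L²(𝕋)` whose Fourier coefficients of negative index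
vanish. -/
def H2 : Submodule ℂ L2T where
  carrier := {f | ∀ n : ℤ, n < 0 → fourierCoeff f n = 0}
  zero_mem' := by
    intro n _
    rw [← fourierBasis_repr]
    simp
  add_mem' := by
    intro f g hf hg n hn
    have h1 := hf n hn
    have h2 := hg n hn
    rw [← fourierBasis_repr] at h1 h2 ⊢
    simp [h1, h2]
  smul_mem' := by
    intro c f hf n hn
    have h1 := hf n hn
    rw [← fourierBasis_repr] at h1 ⊢
    simp [h1]

theorem mem_H2_iff (f : L2T) : f ∈ H2 ↔ ∀ n : ℤ, n < 0 → fourierCoeff f n = 0 := Iff.rfl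

theorem isClosed_H2 : IsClosed (H2 : Set L2T) := by
  have h : (H2 : Set L2T) = ⋂ (n : ℤ) (_ : n < 0), {f : L2T | fourierBasis.repr f n = 0} := by
    ext f
    simp only [SetLike.mem_coe, mem_H2_iff, Set.mem_iInter, Set.mem_ofPred_eq, fourierBasis_repr]
  rw [h]
  refine isClosed_iInter fun n => isClosed_iInter fun _ => isClosed_eq ?_ continuous_const
  have h2 : (fun f : L2T => fourierBasis.repr f n) = fun f : L2T => inner ℂ (fourierBasis n) f := by
    funext f
    exact fourierBasis.repr_apply_apply f n
  rw [h2]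
  fun_prop

instance instCompleteSpaceH2 : CompleteSpace H2 := isClosed_H2.completeSpace_coe

/-- The Riesz projection of `L²(𝕋)` onto `H²`; for the exponent `2` it is the orthogonal
projection. -/
def rieszProj : L2T →L[ℂ] H2 := H2.orthogonalProjectionOnto

/-- Multiplication by the coordinate function `z` on `L²(𝕋)`. -/
def mulZ : L2T →L[ℂ] L2T :=
  (ContinuousLinearMap.mul ℂ ℂ).holderL (haarAddCircle : Measure UnitAddCircle) ∞ 2 2
    (fourierLp ∞ 1)

theorem mulZ_coeFn (f : L2T) :
    (mulZ f : UnitAddCircle → ℂ) =ᵐ[haarAddCircle] fun x => (toCircle x : ℂ) * f x := by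
  have h1 := (ContinuousLinearMap.mul ℂ ℂ).coeFn_holder (r := 2)
    (fourierLp (T := 1) ∞ 1) f
  have h2 := coeFn_fourierLp (T := 1) ∞ 1
  filter_upwards [h1, h2] with x hx1 hx2
  change ((ContinuousLinearMap.mul ℂ ℂ).holder 2 (fourierLp (T := 1) ∞ 1) f) x = _
  rw [hx1, hx2]
  simp

theorem fourierCoeff_toCircle_mul (f : UnitAddCircle → ℂ) (n : ℤ) :
    fourierCoeff (fun x => (toCircle x : ℂ) * f x) n = fourierCoeff f (n - 1) := by
  unfold fourierCoeff
  refine integral_congr_ae (Filter.Eventually.of_forall fun x => ?_)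
  have h : -(n - 1) = -n + 1 := by ring
  simp only [h, fourier_add, fourier_one, smul_eq_mul]
  ring

theorem mulZ_mem_H2 (f : H2) : mulZ f ∈ H2 := by
  intro n hn
  rw [fourierCoeff_congr_ae (mulZ_coeFn f), fourierCoeff_toCircle_mul]
  exact f.2 (n - 1) (by omega)

/-- `T_z` on `H²`, the operator of multiplication by `z`. -/
def shiftH2 : H2 →L[ℂ] H2 := (mulZ.comp H2.subtypeL).codRestrict H2 mulZ_mem_H2

/-- The value at the point `e^{2πix}` of a rational function (all its poles on the circle form a
finite set, which is a null set). -/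
def circleEval (ω : RatFunc ℂ) (x : UnitAddCircle) : ℂ :=
  RatFunc.eval (RingHom.id ℂ) (toCircle x : ℂ) ω

/-- `ρ ∈ Rat₀(𝕋)`: the rational function `ρ` is strictly proper and all its poles lie on the
unit circle. -/
structure IsRatZeroT (ρ : RatFunc ℂ) : Prop where
  poles : ∀ a : ℂ, ρ.denom.IsRoot a → ‖a‖ = 1
  strictlyProper : ρ.num.degree < ρ.denom.degree

theorem ae_eval_ne_zero {p : Polynomial ℂ} (hp : p ≠ 0) :
    ∀ᵐ x : UnitAddCircle ∂haarAddCircle, p.eval (toCircle x : ℂ) ≠ 0 := by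
  have hfin : {x : UnitAddCircle | p.eval (toCircle x : ℂ) = 0}.Finite := by
    have hinj : Function.Injective fun x : UnitAddCircle => (toCircle x : ℂ) :=
      fun x y h => AddCircle.injective_toCircle one_ne_zero (Subtype.ext h)
    refine Set.Finite.subset (Set.Finite.preimage hinj.injOn p.roots.toFinset.finite_toSet) ?_
    intro x hx
    simpa [hp] using hx
  have h0 : (haarAddCircle : Measure UnitAddCircle) {x | p.eval (toCircle x : ℂ) = 0} = 0 := by
    have : NullSingletonClass (volume : Measure UnitAddCircle) := ⟨fun x => by
      rw [← Metric.closedBall_zero, AddCircle.volume_closedBall]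
      simp⟩
    have h1 := hfin.measure_zero (volume : Measure UnitAddCircle)
    simpa [volume_eq_smul_haarAddCircle] using h1
  rw [ae_iff]
  simpa using h0

theorem circleEval_mul_denom (ω : RatFunc ℂ) :
    ∀ᵐ x : UnitAddCircle ∂haarAddCircle,
      circleEval ω x * ω.denom.eval (toCircle x : ℂ) = ω.num.eval (toCircle x : ℂ) := by
  filter_upwards [ae_eval_ne_zero ω.denom_ne_zero] with x hx
  unfold circleEval RatFunc.eval
  simp only [Polynomial.eval₂_id]
  field_simp

theorem circleEval_add (ω ρ : RatFunc ℂ) :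
    ∀ᵐ x : UnitAddCircle ∂haarAddCircle,
      circleEval (ω + ρ) x = circleEval ω x + circleEval ρ x := by
  filter_upwards [ae_eval_ne_zero ω.denom_ne_zero, ae_eval_ne_zero ρ.denom_ne_zero] with x h1 h2
  exact RatFunc.eval_add _ _ h1 h2

theorem circleEval_C_mul (c : ℂ) (ρ : RatFunc ℂ) :
    ∀ᵐ x : UnitAddCircle ∂haarAddCircle,
      circleEval (RatFunc.C c * ρ) x = c * circleEval ρ x := by
  filter_upwards [ae_eval_ne_zero ρ.denom_ne_zero] with x h2
  unfold circleEval
  rw [RatFunc.eval_mul _ _ (by simp) h2]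
  simp

theorem IsRatZeroT.zero : IsRatZeroT 0 :=
  ⟨by simp, by simp⟩

theorem IsRatZeroT.add {ρ σ : RatFunc ℂ} (hρ : IsRatZeroT ρ) (hσ : IsRatZeroT σ) :
    IsRatZeroT (ρ + σ) := by
  constructor
  · intro a ha
    have h := Polynomial.IsRoot.dvd ha (RatFunc.denom_add_dvd ρ σ)
    rcases Polynomial.root_mul.1 h with h | h
    · exact hρ.poles a h
    · exact hσ.poles a h
  · have h := RatFunc.num_denom_add ρ σ
    have d1 : ρ.denom.degree ≠ ⊥ := by simp [ρ.denom_ne_zero]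
    have d2 : σ.denom.degree ≠ ⊥ := by simp [σ.denom_ne_zero]
    have h1 : (ρ.num * σ.denom + ρ.denom * σ.num).degree < (ρ.denom * σ.denom).degree := by
      refine lt_of_le_of_lt (Polynomial.degree_add_le _ _) (max_lt ?_ ?_)
      · rw [Polynomial.degree_mul, Polynomial.degree_mul]
        exact WithBot.add_lt_add_right d2 hρ.strictlyProper
      · rw [Polynomial.degree_mul, Polynomial.degree_mul]
        exact WithBot.add_lt_add_left d1 hσ.strictlyProper
    have h2 := congrArg Polynomial.degree h
    rw [Polynomial.degree_mul, Polynomial.degree_mul (q := (ρ + σ).denom)] at h2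
    have d3 : (ρ + σ).denom.degree ≠ ⊥ := by simp [(ρ + σ).denom_ne_zero]
    have h3 := WithBot.add_lt_add_right d3 h1
    rw [← h2, add_comm _ (ρ + σ).denom.degree] at h3
    exact lt_of_add_lt_add_right h3

theorem IsRatZeroT.C_mul (c : ℂ) {ρ : RatFunc ℂ} (hρ : IsRatZeroT ρ) :
    IsRatZeroT (RatFunc.C c * ρ) := by
  by_cases hc : c = 0
  · subst hc
    simpa using IsRatZeroT.zero
  constructor
  · intro a ha
    have h := Polynomial.IsRoot.dvd ha (RatFunc.denom_mul_dvd (RatFunc.C c) ρ)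
    simp only [RatFunc.denom_C, one_mul] at h
    exact hρ.poles a h
  · have h := RatFunc.num_denom_mul (RatFunc.C c) ρ
    have h2 := congrArg Polynomial.degree h
    simp only [RatFunc.denom_C, one_mul, RatFunc.num_C, Polynomial.degree_mul,
      Polynomial.degree_C hc, zero_add] at h2
    have d3 : (RatFunc.C c * ρ).denom.degree ≠ ⊥ := by simp [(RatFunc.C c * ρ).denom_ne_zero]
    have h3 := WithBot.add_lt_add_right d3 hρ.strictlyProper
    rw [← h2, add_comm _ (RatFunc.C c * ρ).denom.degree] at h3
    exact lt_of_add_lt_add_right h3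

theorem eq_zero_of_abs_const_of_summable {a : ℕ → ℝ} (h : Summable a) (hc : ∀ n, a (n + 1) = a n) :
    ∀ n, a n = 0 := by
  have h0 : ∀ n, a n = a 0 := fun n => by
    induction n with
    | zero => rfl
    | succ k ih => rw [hc, ih]
  have h1 := h.tendsto_atTop_zero
  have h2 : a = fun _ => a 0 := funext h0
  rw [h2] at h1
  have h3 := tendsto_nhds_unique h1 tendsto_const_nhds
  intro n
  rw [h0, ← h3]

/-- A simple pole on the circle is not square integrable. -/
theorem const_eq_zero_of_memLp {k : UnitAddCircle → ℂ} (hk : MemLp k 2 haarAddCircle) {a c : ℂ}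
    (ha : ‖a‖ = 1)
    (h : ∀ᵐ x : UnitAddCircle ∂haarAddCircle, ((toCircle x : ℂ) - a) * k x = c) : c = 0 := by
  have hI : Integrable k haarAddCircle := hk.integrable (by norm_num)
  have hzI : Integrable (fun x : UnitAddCircle => (toCircle x : ℂ) * k x) haarAddCircle := by
    refine hI.bdd_mul (c := 1) ?_ (Filter.Eventually.of_forall fun x => by rw [Circle.norm_coe])
    exact (continuous_subtype_val.comp AddCircle.continuous_toCircle).aestronglyMeasurable
  have hrec : ∀ n : ℤ, fourierCoeff k (n - 1) = a * fourierCoeff k n + if n = 0 then c else 0 := by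
    intro n
    rw [← fourierCoeff_toCircle_mul]
    have e : (fun x : UnitAddCircle => (toCircle x : ℂ) * k x) =ᵐ[haarAddCircle]
        (fun x => a * k x) + fun x => c * fourier 0 x := by
      filter_upwards [h] with x hx
      simp only [Pi.add_apply, fourier_zero, mul_one]
      rw [← hx]
      ring
    rw [fourierCoeff_congr_ae e, fourierCoeff.add (hI.const_mul a)
      (((fourier 0).continuous.integrable_of_hasCompactSupport
        (HasCompactSupport.of_compactSpace _)).const_mul c), Pi.add_apply, fourierCoeff.const_mul,
      fourierCoeff.const_mul, fourierCoeff_fourier]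
    simp [Pi.single_apply]
  have hs : Summable fun n : ℤ => ‖fourierCoeff k n‖ ^ 2 := by
    have := (hasSum_sq_fourierCoeff (hk.toLp k)).summable
    simpa only [fourierCoeff_congr_ae hk.coeFn_toLp] using this
  have hp : ∀ n : ℕ, ‖fourierCoeff k (n : ℤ)‖ ^ 2 = 0 := by
    refine eq_zero_of_abs_const_of_summable (hs.comp_injective Nat.cast_injective) fun n => ?_
    have := hrec ((n : ℤ) + 1)
    rw [if_neg (by omega)] at this
    simp only [add_sub_cancel_right, add_zero] at this
    simp only [this, norm_mul, ha, one_mul, Nat.cast_add, Nat.cast_one]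
  have hm : ∀ n : ℕ, ‖fourierCoeff k (-1 - (n : ℤ))‖ ^ 2 = 0 := by
    refine eq_zero_of_abs_const_of_summable
      (hs.comp_injective (i := fun n : ℕ => -1 - (n : ℤ)) fun m n hmn => by
        simpa using hmn) fun n => ?_
    have := hrec (-1 - (n : ℤ))
    rw [if_neg (by omega), add_zero] at this
    have e : -1 - ((n + 1 : ℕ) : ℤ) = -1 - (n : ℤ) - 1 := by push_cast; ring
    simp only [e, this, norm_mul, ha, one_mul]
  have h0 := hrec 0
  have e1 : fourierCoeff k 0 = 0 := by simpa using hp 0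
  have e2 : fourierCoeff k (-1) = 0 := by simpa using hm 0
  simpa [e1, e2] using h0.symm

theorem dvd_of_memLp (d : ℕ) : ∀ (q p : Polynomial ℂ) (f : UnitAddCircle → ℂ), q ≠ 0 →
    q.natDegree = d → (∀ a : ℂ, q.IsRoot a → ‖a‖ = 1) → MemLp f 2 haarAddCircle →
    (∀ᵐ x : UnitAddCircle ∂haarAddCircle,
      f x * q.eval (toCircle x : ℂ) = p.eval (toCircle x : ℂ)) → q ∣ p := by
  have hbd : ∀ (r : Polynomial ℂ) (f : UnitAddCircle → ℂ), MemLp f 2 haarAddCircle →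
      MemLp (fun x => f x * r.eval (toCircle x : ℂ)) 2 haarAddCircle := by
    intro r f hf
    have hc : Continuous fun x : UnitAddCircle => r.eval (toCircle x : ℂ) :=
      r.continuous.comp (continuous_subtype_val.comp AddCircle.continuous_toCircle)
    have h1 : MemLp (fun x : UnitAddCircle => r.eval (toCircle x : ℂ)) ∞ haarAddCircle :=
      hc.memLp_of_hasCompactSupport (HasCompactSupport.of_compactSpace _)
    exact MemLp.mul' h1 hf
  induction d with
  | zero =>
    intro q p f hq hd _ _ _
    have hu : IsUnit q := by
      rw [Polynomial.isUnit_iff_degree_eq_zero, Polynomial.degree_eq_natDegree hq, hd]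
      rfl
    exact hu.dvd
  | succ d ih =>
    intro q p f hq hd hroot hf h
    obtain ⟨a, ha⟩ := IsAlgClosed.exists_root q (by
      rw [Polynomial.degree_eq_natDegree hq, hd]
      exact_mod_cast Nat.succ_ne_zero d)
    obtain ⟨q', rfl⟩ := Polynomial.dvd_iff_isRoot.2 ha
    have hq' : q' ≠ 0 := right_ne_zero_of_mul hq
    have hna : ‖a‖ = 1 := hroot a ha
    have hpa : p.eval a = 0 := by
      obtain ⟨r, hr⟩ := Polynomial.X_sub_C_dvd_sub_C_eval (a := a) (p := p)
      have hr1 : MemLp (fun x : UnitAddCircle => r.eval (toCircle x : ℂ)) 2 haarAddCircle := by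
        simpa using hbd r (fun _ => 1) (memLp_const 1)
      refine const_eq_zero_of_memLp (k := fun x => f x * q'.eval (toCircle x : ℂ) -
        r.eval (toCircle x : ℂ)) ((hbd q' f hf).sub hr1) hna ?_
      filter_upwards [h] with x hx
      have hr2 := congrArg (Polynomial.eval (toCircle x : ℂ)) hr
      simp only [Polynomial.eval_sub, Polynomial.eval_C, Polynomial.eval_mul,
        Polynomial.eval_X] at hr2 hx
      linear_combination hx + hr2
    obtain ⟨p', rfl⟩ := Polynomial.dvd_iff_isRoot.2 hpa
    refine mul_dvd_mul_left _ (ih q' p' f hq' ?_ ?_ hf ?_)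
    · rw [Polynomial.natDegree_mul (Polynomial.X_sub_C_ne_zero a) hq',
        Polynomial.natDegree_X_sub_C] at hd
      omega
    · intro b hb
      exact hroot b (by simp only [Polynomial.IsRoot.def] at hb ⊢; simp [hb])
    · filter_upwards [h, ae_eval_ne_zero (Polynomial.X_sub_C_ne_zero a)] with x hx hx0
      simp only [Polynomial.eval_mul] at hx
      refine mul_left_cancel₀ hx0 ?_
      linear_combination hx

/-- `L²(𝕋) ∩ Rat₀(𝕋) = {0}`. -/
theorem IsRatZeroT.eq_zero {ρ : RatFunc ℂ} (hρ : IsRatZeroT ρ) (f : L2T)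
    (h : ∀ᵐ x : UnitAddCircle ∂haarAddCircle, f x = circleEval ρ x) : ρ = 0 := by
  have hdvd : ρ.denom ∣ ρ.num := by
    refine dvd_of_memLp _ ρ.denom ρ.num f ρ.denom_ne_zero rfl hρ.poles (Lp.memLp f) ?_
    filter_upwards [h, circleEval_mul_denom ρ] with x h1 h2
    rw [h1, h2]
  exact RatFunc.num_eq_zero_iff.1 (Polynomial.eq_zero_of_dvd_of_degree_lt hdvd hρ.strictlyProper)

/-- The graph of `T_ω`: the pairs `(g, ℙ f)` with `g ∈ H²`, `f ∈ L²` and `ω g = f + ρ` on the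
circle for some `ρ ∈ Rat₀(𝕋)`. -/
def toeplitzGraph (ω : RatFunc ℂ) : Submodule ℂ (H2 × H2) where
  carrier := {gh | ∃ (f : L2T) (ρ : RatFunc ℂ), IsRatZeroT ρ ∧
    (∀ᵐ x : UnitAddCircle ∂haarAddCircle,
      circleEval ω x * (gh.1 : L2T) x = f x + circleEval ρ x) ∧
    gh.2 = rieszProj f}
  zero_mem' := by
    refine ⟨0, 0, IsRatZeroT.zero, ?_, by simp⟩
    exact Filter.Eventually.of_forall fun x => by simp [circleEval]
  add_mem' := by
    rintro ⟨g₁, h₁⟩ ⟨g₂, h₂⟩ ⟨f₁, ρ₁, hρ₁, e₁, rfl⟩ ⟨f₂, ρ₂, hρ₂, e₂, rfl⟩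
    refine ⟨f₁ + f₂, ρ₁ + ρ₂, hρ₁.add hρ₂, ?_, by simp⟩
    filter_upwards [e₁, e₂, circleEval_add ρ₁ ρ₂, Lp.coeFn_add f₁ f₂,
      Lp.coeFn_add (g₁ : L2T) (g₂ : L2T)] with x a₁ a₂ a₃ a₄ a₅
    simp only [Prod.fst_add, Submodule.coe_add] at a₁ a₂ ⊢
    rw [a₃, a₄, a₅]
    simp only [Pi.add_apply]
    linear_combination a₁ + a₂
  smul_mem' := by
    rintro c ⟨g, h⟩ ⟨f, ρ, hρ, e, rfl⟩
    refine ⟨c • f, RatFunc.C c * ρ, hρ.C_mul c, ?_, by simp⟩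
    filter_upwards [e, circleEval_C_mul c ρ, Lp.coeFn_smul c f,
      Lp.coeFn_smul c (g : L2T)] with x a₁ a₃ a₄ a₅
    simp only [Prod.smul_fst, Submodule.coe_smul] at a₁ ⊢
    rw [a₃, a₄, a₅]
    simp only [Pi.smul_apply, smul_eq_mul]
    linear_combination c * a₁

theorem toeplitzGraph_single_valued (ω : RatFunc ℂ) (y : H2 × H2) (hy : y ∈ toeplitzGraph ω)
    (hy0 : y.1 = 0) : y.2 = 0 := by
  obtain ⟨f, ρ, hρ, e, h2⟩ := hy
  have hρ0 : RatFunc.C (-1) * ρ = 0 := by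
    refine (hρ.C_mul (-1)).eq_zero f ?_
    filter_upwards [e, circleEval_C_mul (-1) ρ,
      Lp.coeFn_zero ℂ 2 (haarAddCircle : Measure UnitAddCircle)] with x a₁ a₂ a₃
    rw [a₂]
    rw [hy0, Submodule.coe_zero, a₃] at a₁
    simp only [Pi.zero_apply, mul_zero] at a₁
    linear_combination -a₁
  have hρ1 : ρ = 0 := by simpa using hρ0
  have hf : f = 0 := by
    rw [Lp.eq_zero_iff_ae_eq_zero]
    filter_upwards [e, Lp.coeFn_zero ℂ 2 (haarAddCircle : Measure UnitAddCircle)] with x a₁ a₃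
    rw [hy0, Submodule.coe_zero, a₃, hρ1] at a₁
    simpa [circleEval] using a₁.symm
  rw [h2, hf, map_zero]

/-- The Toeplitz-like operator `T_ω (H² → H²)`:
`Dom(T_ω) = {g ∈ H² : ω g = f + ρ with f ∈ L², ρ ∈ Rat₀(𝕋)}` and `T_ω g = ℙ f`. -/
def toeplitz (ω : RatFunc ℂ) : H2 →ₗ.[ℂ] H2 := (toeplitzGraph ω).toLinearPMap

theorem toeplitz_graph (ω : RatFunc ℂ) : (toeplitz ω).graph = toeplitzGraph ω :=
  Submodule.toLinearPMap_graph_eq _ fun y hy hy0 => toeplitzGraph_single_valued ω y hy hy0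

/-- The composition `T A` of an unbounded operator `T` and a bounded operator `A`, on its maximal
domain `{f : A f ∈ Dom(T)}`. -/
def pmapCompCLM (T : H2 →ₗ.[ℂ] H2) (A : H2 →L[ℂ] H2) : H2 →ₗ.[ℂ] H2 where
  domain := T.domain.comap (A : H2 →ₗ[ℂ] H2)
  toFun := T.toFun ∘ₗ (A : H2 →ₗ[ℂ] H2).restrict fun _ hf => hf

/-- Sarason-Toeplitz operators on `H²`: closed, densely defined operators which satisfy Sarason's
three algebraic axioms. The equality in `adjoint_comp_comp` is one of unbounded operators, so it
includes the equality of the domains; `fourierCoeff f 0` is the value `f(0)`. -/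
structure IsSarasonToeplitz (T : H2 →ₗ.[ℂ] H2) : Prop where
  closed : T.IsClosed
  dense_domain : Dense (T.domain : Set H2)
  shift_mem : ∀ f ∈ T.domain, shiftH2 f ∈ T.domain
  adjoint_comp_comp :
    (ContinuousLinearMap.adjoint shiftH2 : H2 →ₗ[ℂ] H2).compPMap (pmapCompCLM T shiftH2) = T
  backward_mem : ∀ f ∈ T.domain, fourierCoeff (f : L2T) 0 = 0 →
    ContinuousLinearMap.adjoint shiftH2 f ∈ T.domain

end

open Polynomial

/-! ### Fourier coefficients on `L²(𝕋)` -/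

/-! Write `ω = p / q` in lowest terms and let `S` be the shift on `H²`.

Sarason's axioms come from the behaviour of `Rat₀(𝕋)` under multiplication by `z` and `z⁻¹`. For `ρ`
in `Rat₀(𝕋)`, `z ρ` is a constant plus an element of `Rat₀(𝕋)`, and since `0` is not a pole, so is
`z⁻¹ ρ` up to a multiple of `z⁻¹`. Multiplying `ω g = f + ρ` by `z` or `z⁻¹` therefore gives `g ∈
Dom(T_ω)` if and only if `S g ∈ Dom(T_ω)` (`toeplitzGraph_shift`, `toeplitzGraph_of_shift`). The
constant only affects the zeroth coefficient of `T_ω S g`, which `S*` deletes, so `S* T_ω S = T_ω`.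
The third axiom follows from `S S* f = f` when `f(0) = 0`.

Density: by partial fractions `1` is in the domain, hence so is every `zⁿ` with `n ≥ 0`.

Closedness: consider the bounded map `Φ(g, h) = p g - q h`. Its kernel lies in the graph, because `p
g = q h` says `ω g = h`. Its image of the graph is finite-dimensional (`fourierCoeff_clearDenom`).
So the graph is the preimage under `Φ` of a closed subspace. -/

theorem fourierCoeff_eq_inner (f : L2T) (n : ℤ) :
    fourierCoeff f n = inner ℂ (fourierBasis n : L2T) f := by
  rw [← fourierBasis_repr, HilbertBasis.repr_apply_apply]

theorem L2T_ext {f g : L2T} (h : ∀ n : ℤ, fourierCoeff f n = fourierCoeff g n) : f = g := by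
  apply fourierBasis.repr.injective
  ext n
  simpa only [fourierBasis_repr] using h n

theorem H2_ext {f g : H2}
    (h : ∀ n : ℤ, 0 ≤ n → fourierCoeff (f : L2T) n = fourierCoeff (g : L2T) n) : f = g := by
  refine Subtype.ext (L2T_ext fun n => ?_)
  rcases lt_or_ge n 0 with hn | hn
  · rw [f.2 n hn, g.2 n hn]
  · exact h n hn

theorem fourierCoeff_fourierBasis (m n : ℤ) :
    fourierCoeff (fourierBasis m : L2T) n = if n = m then 1 else 0 := by
  rw [fourierCoeff_eq_inner]
  exact orthonormal_iff_ite.1 fourierBasis.orthonormal n m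

theorem fourierBasis_mem_H2 {n : ℤ} (hn : 0 ≤ n) : (fourierBasis n : L2T) ∈ H2 := by
  intro m hm
  rw [fourierCoeff_fourierBasis, if_neg (by omega)]

theorem fourierCoeff_mulZ (f : L2T) (n : ℤ) :
    fourierCoeff (mulZ f) n = fourierCoeff f (n - 1) := by
  rw [fourierCoeff_congr_ae (mulZ_coeFn f), fourierCoeff_toCircle_mul]

theorem mulZ_fourierBasis (n : ℤ) : mulZ (fourierBasis n) = fourierBasis (n + 1) := by
  refine L2T_ext fun m => ?_
  rw [fourierCoeff_mulZ, fourierCoeff_fourierBasis, fourierCoeff_fourierBasis]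
  simp only [sub_eq_iff_eq_add]

theorem coe_shiftH2 (f : H2) : (shiftH2 f : L2T) = mulZ f := rfl

theorem fourierCoeff_rieszProj (f : L2T) {n : ℤ} (hn : 0 ≤ n) :
    fourierCoeff (rieszProj f : L2T) n = fourierCoeff f n := by
  have h := Submodule.inner_orthogonalProjectionOnto_eq_of_mem_left
    (K := H2) ⟨_, fourierBasis_mem_H2 hn⟩ f
  rw [fourierCoeff_eq_inner, fourierCoeff_eq_inner]
  exact h

theorem rieszProj_coe (h : H2) : rieszProj (h : L2T) = h :=
  Submodule.orthogonalProjectionOnto_mem_subspace_eq_self h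

theorem fourierCoeff_adjoint_shiftH2 (f : H2) {n : ℤ} (hn : 0 ≤ n) :
    fourierCoeff (ContinuousLinearMap.adjoint shiftH2 f : L2T) n = fourierCoeff (f : L2T) (n + 1) := by
  have h := ContinuousLinearMap.adjoint_inner_right shiftH2 ⟨_, fourierBasis_mem_H2 hn⟩ f
  rw [Submodule.coe_inner, Submodule.coe_inner, coe_shiftH2, mulZ_fourierBasis] at h
  rw [fourierCoeff_eq_inner, fourierCoeff_eq_inner]
  exact h

theorem shiftH2_adjoint_of_fourierCoeff_zero {f : H2} (hf : fourierCoeff (f : L2T) 0 = 0) :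
    shiftH2 (ContinuousLinearMap.adjoint shiftH2 f) = f := by
  refine H2_ext fun n hn => ?_
  rw [coe_shiftH2, fourierCoeff_mulZ]
  rcases hn.eq_or_lt with rfl | hn
  · rw [hf]
    -- The coefficient in question has index `-1`, which vanishes for every element of `H²`.
    exact (ContinuousLinearMap.adjoint shiftH2 f).2 _ (by norm_num)
  · rw [fourierCoeff_adjoint_shiftH2 _ (by omega), sub_add_cancel]

/-! ### Multiplication by polynomials and continuous functions -/

theorem fourierCoeff_mulZ_pow (k : ℕ) (f : L2T) (n : ℤ) :
    fourierCoeff ((mulZ ^ k) f) n = fourierCoeff f (n - k) := by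
  induction k generalizing n with
  | zero => simp
  | succ k ih =>
    rw [pow_succ', mul_apply_eq_comp, fourierCoeff_mulZ, ih]
    congr 1
    push_cast
    ring

theorem fourierCoeff_aeval_mulZ (p : ℂ[X]) (f : L2T) (n : ℤ) :
    fourierCoeff (aeval mulZ p f) n =
      ∑ k ∈ Finset.range (p.natDegree + 1), p.coeff k * fourierCoeff f (n - k) := by
  rw [fourierCoeff_eq_inner, aeval_eq_sum_range, sum_apply, inner_sum]
  refine Finset.sum_congr rfl fun k _ => ?_
  rw [← fourierCoeff_mulZ_pow, fourierCoeff_eq_inner, smul_apply, inner_smul_right]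

theorem aeval_mulZ_coeFn (p : ℂ[X]) (f : L2T) :
    (aeval mulZ p f : UnitAddCircle → ℂ) =ᵐ[haarAddCircle]
      fun x => p.eval (toCircle x : ℂ) * f x := by
  induction p using Polynomial.induction_on' with
  | add p q hp hq =>
    rw [map_add, add_apply]
    filter_upwards [hp, hq, Lp.coeFn_add (aeval mulZ p f) (aeval mulZ q f)] with x h1 h2 h3
    rw [h3, Pi.add_apply, h1, h2, eval_add]
    ring
  | monomial k a =>
    rw [aeval_monomial]
    have hpow : (((mulZ ^ k) f : L2T) : UnitAddCircle → ℂ) =ᵐ[haarAddCircle]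
        fun x => (toCircle x : ℂ) ^ k * f x := by
      induction k with
      | zero => simp
      | succ k ih =>
        rw [pow_succ', mul_apply_eq_comp]
        filter_upwards [ih, mulZ_coeFn ((mulZ ^ k) f)] with x h1 h2
        rw [h2, h1]
        ring
    rw [← Algebra.smul_def, smul_apply]
    filter_upwards [hpow, Lp.coeFn_smul a ((mulZ ^ k) f)] with x h1 h2
    rw [h2, Pi.smul_apply, h1, eval_monomial, smul_eq_mul]
    ring

theorem aeval_mulZ_mem_H2 (p : ℂ[X]) (f : H2) : aeval mulZ p (f : L2T) ∈ H2 := by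
  intro n hn
  rw [fourierCoeff_aeval_mulZ]
  exact Finset.sum_eq_zero fun k _ => by rw [f.2 _ (by omega), mul_zero]

theorem fourierBasis_zero_coeFn :
    ((fourierBasis 0 : L2T) : UnitAddCircle → ℂ) =ᵐ[haarAddCircle] fun _ => 1 := by
  rw [coe_fourierBasis]
  filter_upwards [coeFn_fourierLp (T := 1) 2 0] with x hx
  rw [hx, fourier_zero]

theorem exists_L2T_mul {φ : UnitAddCircle → ℂ} (hφ : Continuous φ) (f : L2T) :
    ∃ g : L2T, ∀ᵐ x : UnitAddCircle ∂haarAddCircle, g x = φ x * f x := by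
  have h1 : MemLp φ ∞ haarAddCircle :=
    hφ.memLp_of_hasCompactSupport (HasCompactSupport.of_compactSpace _)
  have h2 : MemLp (fun x => φ x * f x) 2 haarAddCircle := MemLp.mul' (Lp.memLp f) h1
  exact ⟨h2.toLp, h2.coeFn_toLp⟩

theorem continuous_coe_toCircle : Continuous fun x : UnitAddCircle => (toCircle x : ℂ) :=
  continuous_subtype_val.comp AddCircle.continuous_toCircle

/-- The functions whose Fourier series is supported in a fixed finite set are trigonometric
polynomials. -/
theorem mem_span_fourierBasis (s : Finset ℤ) {u : L2T}
    (hu : ∀ n ∉ s, fourierCoeff u n = 0) :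
    u ∈ Submodule.span ℂ ((fun n : ℤ => (fourierBasis n : L2T)) '' s) := by
  have h1 : HasSum (fun n : ℤ => fourierCoeff u n • (fourierBasis n : L2T)) u := by
    simpa only [fourierBasis_repr] using fourierBasis.hasSum_repr u
  have h2 : u = ∑ n ∈ s, fourierCoeff u n • (fourierBasis n : L2T) :=
    h1.unique (hasSum_sum_of_ne_finset_zero fun n hn => by rw [hu n hn, zero_smul])
  rw [h2]
  exact Submodule.sum_mem _ fun n hn =>
    Submodule.smul_mem _ _ (Submodule.subset_span ⟨n, hn, rfl⟩)

/-! ### Rational functions on the circle -/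

theorem circleEval_mul_eval {ρ : RatFunc ℂ} {r s : ℂ[X]} (hs : s ≠ 0)
    (h : ρ = algebraMap ℂ[X] (RatFunc ℂ) r / algebraMap ℂ[X] (RatFunc ℂ) s) :
    ∀ᵐ x : UnitAddCircle ∂haarAddCircle,
      circleEval ρ x * s.eval (toCircle x : ℂ) = r.eval (toCircle x : ℂ) := by
  have h1 := (RatFunc.num_mul_eq_mul_denom_iff hs).2 h
  filter_upwards [circleEval_mul_denom ρ, ae_eval_ne_zero ρ.denom_ne_zero] with x hx hx0
  have h2 := congrArg (Polynomial.eval (toCircle x : ℂ)) h1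
  rw [eval_mul, eval_mul, ← hx] at h2
  refine mul_right_cancel₀ hx0 ?_
  linear_combination h2

/-- A strictly proper fraction whose denominator has all its roots on the circle is in
`Rat₀(𝕋)`. -/
theorem exists_isRatZeroT {r s : ℂ[X]} (hs : s ≠ 0) (hroot : ∀ a : ℂ, s.IsRoot a → ‖a‖ = 1)
    (hdeg : r.degree < s.degree) :
    ∃ ρ : RatFunc ℂ, IsRatZeroT ρ ∧ ∀ᵐ x : UnitAddCircle ∂haarAddCircle,
      circleEval ρ x * s.eval (toCircle x : ℂ) = r.eval (toCircle x : ℂ) := by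
  set ρ : RatFunc ℂ := algebraMap ℂ[X] (RatFunc ℂ) r / algebraMap ℂ[X] (RatFunc ℂ) s with hρ
  refine ⟨ρ, ⟨fun a ha => hroot a (ha.dvd (RatFunc.denom_div_dvd r s)), ?_⟩,
    circleEval_mul_eval hs hρ⟩
  -- Since `r / s` need not be in lowest terms, the degree inequality is carried to `num` and
  -- `denom` by cross-multiplication.
  have h1 := congrArg Polynomial.degree ((RatFunc.num_mul_eq_mul_denom_iff hs).2 hρ)
  rw [degree_mul, degree_mul] at h1
  have h2 := WithBot.add_lt_add_right (by simp [ρ.denom_ne_zero] : ρ.denom.degree ≠ ⊥) hdeg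
  rw [← h1, add_comm s.degree] at h2
  exact lt_of_add_lt_add_right h2

/-- Division with remainder of `X * num` by `denom`: strict properness makes the quotient constant,
and the remainder over `denom` is again in `Rat₀(𝕋)`. -/
theorem IsRatZeroT.exists_mul_coord {ρ : RatFunc ℂ} (hρ : IsRatZeroT ρ) :
    ∃ (c : ℂ) (σ : RatFunc ℂ), IsRatZeroT σ ∧ ∀ᵐ x : UnitAddCircle ∂haarAddCircle,
      (toCircle x : ℂ) * circleEval ρ x = c + circleEval σ x := by
  have hs := ρ.monic_denom
  set r := ρ.num with hr
  set s := ρ.denom with hs'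
  have hdeg : (X * r) /ₘ s = C (((X * r) /ₘ s).coeff 0) := by
    refine eq_C_of_natDegree_le_zero ?_
    rw [natDegree_divByMonic _ hs]
    by_cases h0 : r = 0
    · simp [h0]
    · rw [natDegree_mul X_ne_zero h0, natDegree_X]
      have : r.natDegree < s.natDegree := natDegree_lt_natDegree h0 hρ.strictlyProper
      omega
  obtain ⟨σ, hσ, e⟩ := exists_isRatZeroT (r := (X * r) %ₘ s) ρ.denom_ne_zero hρ.poles
    (degree_modByMonic_lt _ hs)
  refine ⟨((X * r) /ₘ s).coeff 0, σ, hσ, ?_⟩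
  filter_upwards [e, circleEval_mul_denom ρ, ae_eval_ne_zero ρ.denom_ne_zero] with x h1 h2 h3
  have h4 := congrArg (Polynomial.eval (toCircle x : ℂ)) (modByMonic_add_div (X * r) s)
  rw [hdeg] at h4
  simp only [eval_add, eval_mul, eval_C, eval_X] at h4
  refine mul_right_cancel₀ h3 ?_
  linear_combination (toCircle x : ℂ) * h2 - h4 - h1

/-- All poles have modulus one, so `ρ(0)` makes sense. With `c = ρ(0)`, the numerator of `ρ - c` is
divisible by `X`, and `(ρ - c) / z` is strictly proper with poles among those of `ρ`. -/
theorem IsRatZeroT.exists_inv_mul_coord {ρ : RatFunc ℂ} (hρ : IsRatZeroT ρ) :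
    ∃ (c : ℂ) (σ : RatFunc ℂ), IsRatZeroT σ ∧ ∀ᵐ x : UnitAddCircle ∂haarAddCircle,
      (toCircle x : ℂ)⁻¹ * circleEval ρ x = (toCircle x : ℂ)⁻¹ * c + circleEval σ x := by
  have hs0 : ρ.denom.eval 0 ≠ 0 := fun h => by simpa using hρ.poles 0 h
  set c : ℂ := ρ.num.eval 0 / ρ.denom.eval 0 with hc
  obtain ⟨t, ht⟩ : X ∣ ρ.num - C c * ρ.denom := by
    rw [X_dvd_iff, coeff_zero_eq_eval_zero, eval_sub, eval_mul, eval_C, hc,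
      div_mul_cancel₀ _ hs0, sub_self]
  have hdeg : t.degree < ρ.denom.degree := by
    have h1 : (X * t).degree ≤ ρ.denom.degree := by
      rw [← ht]
      refine (degree_sub_le _ _).trans (max_le hρ.strictlyProper.le ?_)
      rw [degree_mul]
      exact (add_le_add_left degree_C_le _).trans_eq (zero_add _)
    by_cases h0 : t = 0
    · rw [h0, degree_zero, bot_lt_iff_ne_bot]
      simp [ρ.denom_ne_zero]
    · refine lt_of_lt_of_le ?_ h1
      rw [mul_comm]
      exact degree_lt_degree_mul_X h0
  obtain ⟨σ, hσ, e⟩ := exists_isRatZeroT ρ.denom_ne_zero hρ.poles hdeg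
  refine ⟨c, σ, hσ, ?_⟩
  filter_upwards [e, circleEval_mul_denom ρ, ae_eval_ne_zero ρ.denom_ne_zero] with x h1 h2 h3
  have h4 := congrArg (Polynomial.eval (toCircle x : ℂ)) ht
  simp only [eval_sub, eval_mul, eval_C, eval_X] at h4
  have hz : (toCircle x : ℂ)⁻¹ * (toCircle x : ℂ) = 1 := inv_mul_cancel₀ (Circle.coe_ne_zero _)
  refine mul_right_cancel₀ h3 ?_
  linear_combination (toCircle x : ℂ)⁻¹ * (h2 + h4) + t.eval (toCircle x : ℂ) * hz - h1

/-! ### The shift and the graph of `T_ω` -/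

theorem toeplitzGraph_shift {ω : RatFunc ℂ} {g h : H2} (hgh : (g, h) ∈ toeplitzGraph ω) :
    ∃ h' : H2, (shiftH2 g, h') ∈ toeplitzGraph ω ∧ ContinuousLinearMap.adjoint shiftH2 h' = h := by
  obtain ⟨f, ρ, hρ, e, rfl⟩ := hgh
  obtain ⟨c, σ, hσ, e'⟩ := hρ.exists_mul_coord
  -- From `z ω g = z f + z ρ` and `z ρ = c + σ`, the square integrable part is `z f + c`.
  refine ⟨rieszProj (mulZ f + c • (fourierBasis 0 : L2T)), ⟨_, σ, hσ, ?_, rfl⟩, ?_⟩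
  · filter_upwards [e, e', mulZ_coeFn f, mulZ_coeFn (g : L2T), fourierBasis_zero_coeFn,
      Lp.coeFn_add (mulZ f) (c • (fourierBasis 0 : L2T)),
      Lp.coeFn_smul c (fourierBasis 0 : L2T)] with x h1 h2 h3 h4 h5 h6 h7
    simp only [coe_shiftH2] at h1 ⊢
    rw [h6, Pi.add_apply, h7, Pi.smul_apply, h5, h3, h4, smul_eq_mul]
    linear_combination (toCircle x : ℂ) * h1 + h2
  · refine H2_ext fun n hn => ?_
    -- The adjoint reads the coefficient of index `n + 1 ≥ 1`, where the constant `c` contributes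
    -- nothing.
    rw [fourierCoeff_adjoint_shiftH2 _ hn, fourierCoeff_rieszProj _ (by omega),
      fourierCoeff_rieszProj _ hn, fourierCoeff_eq_inner, inner_add_right, inner_smul_right,
      ← fourierCoeff_eq_inner, ← fourierCoeff_eq_inner, fourierCoeff_mulZ,
      fourierCoeff_fourierBasis, if_neg (by omega), add_sub_cancel_right, mul_zero, add_zero]

theorem toeplitzGraph_of_shift {ω : RatFunc ℂ} {g h' : H2}
    (hgh : (shiftH2 g, h') ∈ toeplitzGraph ω) : ∃ h : H2, (g, h) ∈ toeplitzGraph ω := by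
  obtain ⟨f, ρ, hρ, e, -⟩ := hgh
  obtain ⟨c, σ, hσ, e'⟩ := hρ.exists_inv_mul_coord
  obtain ⟨k, hk⟩ := exists_L2T_mul
    (continuous_coe_toCircle.inv₀ fun x : UnitAddCircle => Circle.coe_ne_zero (toCircle x))
    (f + c • (fourierBasis 0 : L2T))
  refine ⟨rieszProj k, k, σ, hσ, ?_, rfl⟩
  filter_upwards [e, e', hk, mulZ_coeFn (g : L2T), fourierBasis_zero_coeFn,
    Lp.coeFn_add f (c • (fourierBasis 0 : L2T)),
    Lp.coeFn_smul c (fourierBasis 0 : L2T)] with x h1 h2 h3 h4 h5 h6 h7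
  simp only [coe_shiftH2] at h1 ⊢
  rw [h3, h6, Pi.add_apply, h7, Pi.smul_apply, h5, smul_eq_mul]
  rw [h4] at h1
  have hz : (toCircle x : ℂ)⁻¹ * (toCircle x : ℂ) = 1 := inv_mul_cancel₀ (Circle.coe_ne_zero _)
  linear_combination (toCircle x : ℂ)⁻¹ * h1 + h2 - circleEval ω x * (g : L2T) x * hz

/-! ### The domain is dense -/

/-- Separates the poles of `ω` off the circle, which give a continuous function on it, from those on
the circle, which give the `Rat₀(𝕋)` part. -/
theorem exists_eq_mul_circle_roots {q : ℂ[X]} (hq : q ≠ 0) :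
    ∃ q₀ q₁ : ℂ[X], q = q₀ * q₁ ∧ (∀ a : ℂ, q₀.IsRoot a → ‖a‖ ≠ 1) ∧
      ∀ a : ℂ, q₁.IsRoot a → ‖a‖ = 1 := by
  induction hd : q.natDegree generalizing q with
  | zero =>
    refine ⟨q, 1, (mul_one q).symm, fun a ha => ?_, fun a ha => ?_⟩
    · rw [eq_C_of_natDegree_eq_zero hd] at ha hq
      simp only [IsRoot.def, eval_C] at ha
      simp [ha] at hq
    · simp at ha
  | succ d ih =>
    obtain ⟨a, ha⟩ := IsAlgClosed.exists_root q (by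
      rw [Polynomial.degree_eq_natDegree hq, hd]
      exact_mod_cast Nat.succ_ne_zero d)
    obtain ⟨q', rfl⟩ := dvd_iff_isRoot.2 ha
    have hq' : q' ≠ 0 := right_ne_zero_of_mul hq
    rw [natDegree_mul (X_sub_C_ne_zero a) hq', natDegree_X_sub_C] at hd
    obtain ⟨q₀, q₁, rfl, h0, h1⟩ := ih hq' (by omega)
    by_cases hna : ‖a‖ = 1
    · refine ⟨q₀, (X - C a) * q₁, by ring, h0, fun b hb => ?_⟩
      rcases root_mul.1 hb with hb | hb
      · rwa [← root_X_sub_C.1 hb]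
      · exact h1 b hb
    · refine ⟨(X - C a) * q₀, q₁, by ring, fun b hb => ?_, h1⟩
      rcases root_mul.1 hb with hb | hb
      · rwa [← root_X_sub_C.1 hb]
      · exact h0 b hb

/-- Partial fractions: if `a q₀ + b q₁ = 1` then `p / (q₀ q₁) = p b / q₀ + p a / q₁`. The quotient
of `p a` by `q₁` joins the first term, which is continuous on the circle; the remainder over `q₁` is
in `Rat₀(𝕋)`. -/
theorem one_mem_toeplitzGraph (ω : RatFunc ℂ) :
    ∃ h : H2, ((⟨fourierBasis 0, fourierBasis_mem_H2 le_rfl⟩ : H2), h) ∈ toeplitzGraph ω := by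
  obtain ⟨q₀, q₁, hq, h0, h1⟩ := exists_eq_mul_circle_roots ω.denom_ne_zero
  have hq₁ : q₁ ≠ 0 := fun h => ω.denom_ne_zero (by rw [hq, h, mul_zero])
  obtain ⟨a, b, hab⟩ : IsCoprime q₀ q₁ := by
    rw [isCoprime_iff_aeval_ne_zero_of_isAlgClosed ℂ ℂ]
    intro z
    by_contra! hz
    simp only [coe_aeval_eq_eval] at hz
    exact h0 z hz.1 (h1 z hz.2)
  obtain ⟨σ, hσ, e⟩ := exists_isRatZeroT (r := (ω.num * a) % q₁) hq₁ h1
    (EuclideanDomain.mod_lt _ hq₁)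
  have hne (x : UnitAddCircle) : q₀.eval (toCircle x : ℂ) ≠ 0 := fun h => h0 _ h (Circle.norm_coe _)
  obtain ⟨f, hf⟩ := exists_L2T_mul (φ := fun x : UnitAddCircle =>
      (ω.num * b + ω.num * a / q₁ * q₀).eval (toCircle x : ℂ) / q₀.eval (toCircle x : ℂ))
    (((Polynomial.continuous _).comp continuous_coe_toCircle).div
      ((Polynomial.continuous _).comp continuous_coe_toCircle) hne) (fourierBasis 0)
  refine ⟨rieszProj f, f, σ, hσ, ?_, rfl⟩
  filter_upwards [e, hf, fourierBasis_zero_coeFn, circleEval_mul_denom ω, ae_eval_ne_zero hq₁]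
    with x e1 e2 e3 e4 e5
  have e6 := congrArg (Polynomial.eval (toCircle x : ℂ)) hab
  have e7 := congrArg (Polynomial.eval (toCircle x : ℂ)) (EuclideanDomain.mod_add_div (ω.num * a) q₁)
  have e8 := hne x
  rw [hq] at e4
  rw [e2, e3, mul_one, mul_one]
  simp only [eval_add, eval_mul, eval_one] at e4 e6 e7 ⊢
  refine mul_right_cancel₀ (mul_ne_zero e8 e5) ?_
  rw [e4, add_mul, div_mul_eq_mul_div, mul_div_assoc, mul_div_cancel_left₀ _ e8]
  linear_combination (-q₀.eval (toCircle x : ℂ)) * e1 - ω.num.eval (toCircle x : ℂ) * e6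
    - q₀.eval (toCircle x : ℂ) * e7

theorem mem_toeplitz_domain {ω : RatFunc ℂ} {g : H2} :
    g ∈ (toeplitz ω).domain ↔ ∃ h, (g, h) ∈ toeplitzGraph ω := by
  rw [LinearPMap.mem_domain_iff, toeplitz_graph]

theorem fourierBasis_mem_toeplitz_domain (ω : RatFunc ℂ) (n : ℕ) :
    (⟨fourierBasis n, fourierBasis_mem_H2 n.cast_nonneg⟩ : H2) ∈ (toeplitz ω).domain := by
  induction n with
  | zero => exact mem_toeplitz_domain.2 (one_mem_toeplitzGraph ω)
  | succ n ih =>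
    obtain ⟨h, hh⟩ := mem_toeplitz_domain.1 ih
    obtain ⟨h', hh', -⟩ := toeplitzGraph_shift hh
    refine mem_toeplitz_domain.2 ⟨h', ?_⟩
    convert hh' using 2
    refine Subtype.ext ?_
    rw [coe_shiftH2, mulZ_fourierBasis]
    push_cast
    rfl

theorem dense_toeplitz_domain (ω : RatFunc ℂ) : Dense ((toeplitz ω).domain : Set H2) := by
  rw [Submodule.dense_iff_topologicalClosure_eq_top, Submodule.topologicalClosure_eq_top_iff,
    Submodule.eq_bot_iff]
  intro f hf
  refine H2_ext fun n hn => ?_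
  lift n to ℕ using hn
  have h1 := (Submodule.mem_orthogonal _ _).1 hf _ (fourierBasis_mem_toeplitz_domain ω n)
  rw [Submodule.coe_inner] at h1
  rw [fourierCoeff_eq_inner, fourierCoeff_eq_inner, h1, Submodule.coe_zero, inner_zero_right]

/-! ### The graph is closed -/

/-- The map `(g, h) ↦ p g - q h`, where `ω = p / q` in lowest terms. -/
noncomputable def clearDenom (ω : RatFunc ℂ) : H2 × H2 →L[ℂ] L2T :=
  (aeval mulZ ω.num).comp (H2.subtypeL.comp (ContinuousLinearMap.fst ℂ H2 H2)) -
    (aeval mulZ ω.denom).comp (H2.subtypeL.comp (ContinuousLinearMap.snd ℂ H2 H2))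

theorem clearDenom_apply (ω : RatFunc ℂ) (g h : H2) :
    clearDenom ω (g, h) = aeval mulZ ω.num (g : L2T) - aeval mulZ ω.denom (h : L2T) := rfl

theorem ker_clearDenom_le (ω : RatFunc ℂ) :
    (clearDenom ω : H2 × H2 →ₗ[ℂ] L2T).ker ≤ toeplitzGraph ω := by
  rintro ⟨g, h⟩ hgh
  have h0 : aeval mulZ ω.num (g : L2T) = aeval mulZ ω.denom (h : L2T) :=
    sub_eq_zero.1 (LinearMap.mem_ker.1 hgh)
  -- Here `ω g = h` already lies in `H²`, so no `Rat₀(𝕋)` part is needed and `h` is its own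
  -- projection.
  refine ⟨h, 0, IsRatZeroT.zero, ?_, (rieszProj_coe h).symm⟩
  filter_upwards [aeval_mulZ_coeFn ω.num (g : L2T), aeval_mulZ_coeFn ω.denom (h : L2T),
    circleEval_mul_denom ω, ae_eval_ne_zero ω.denom_ne_zero] with x h1 h2 h3 h4
  rw [h0, h2, ← h3] at h1
  have h5 : circleEval 0 x = 0 := by simp [circleEval]
  rw [h5, add_zero]
  refine mul_right_cancel₀ h4 ?_
  linear_combination -h1

/-- If `q ρ` is square integrable then it is a polynomial of degree less than that
of `q`. -/
theorem IsRatZeroT.exists_polynomial {ρ : RatFunc ℂ} (hρ : IsRatZeroT ρ) {q : ℂ[X]} (hq : q ≠ 0)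
    (u : L2T) (hu : ∀ᵐ x : UnitAddCircle ∂haarAddCircle,
      u x = q.eval (toCircle x : ℂ) * circleEval ρ x) :
    ∃ t : ℂ[X], t.degree < q.degree ∧ u = aeval mulZ t (fourierBasis 0 : L2T) := by
  -- A square integrable function times `denom` equals `q * num`; as the roots of `denom` are on the
  -- circle, all of them must cancel.
  obtain ⟨t, ht⟩ : ρ.denom ∣ q * ρ.num := by
    refine dvd_of_memLp _ ρ.denom _ u ρ.denom_ne_zero rfl hρ.poles (Lp.memLp u) ?_
    filter_upwards [hu, circleEval_mul_denom ρ] with x h1 h2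
    rw [h1, mul_assoc, h2, eval_mul]
  refine ⟨t, ?_, ?_⟩
  · have h1 := congrArg Polynomial.degree ht
    rw [degree_mul, degree_mul] at h1
    have h2 := WithBot.add_lt_add_left (by simp [hq] : q.degree ≠ ⊥) hρ.strictlyProper
    rw [h1, add_comm q.degree] at h2
    exact lt_of_add_lt_add_left h2
  · refine Lp.ext ?_
    filter_upwards [hu, circleEval_mul_denom ρ, aeval_mulZ_coeFn t (fourierBasis 0 : L2T),
      fourierBasis_zero_coeFn, ae_eval_ne_zero ρ.denom_ne_zero] with x h1 h2 h3 h4 h5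
    have h6 := congrArg (Polynomial.eval (toCircle x : ℂ)) ht
    rw [eval_mul, eval_mul] at h6
    rw [h3, h4, h1]
    refine mul_right_cancel₀ h5 ?_
    linear_combination q.eval (toCircle x : ℂ) * h2 + h6

/-- If `ω g = f + ρ` then `p g - q f = q ρ` is square integrable, hence a polynomial `t` of degree
below `deg q`, and `p g - q ℙf = t + q (f - ℙf)`. As `f - ℙf` has only negative frequencies, nothing
remains at index `deg q` or above; negative indices vanish because `p g` and `q ℙf` are in `H²`. -/
theorem fourierCoeff_clearDenom {ω : RatFunc ℂ} {y : H2 × H2} (hy : y ∈ toeplitzGraph ω) {n : ℤ}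
    (hn : n ∉ Finset.Ico (0 : ℤ) ω.denom.natDegree) : fourierCoeff (clearDenom ω y) n = 0 := by
  obtain ⟨g, h⟩ := y
  rcases lt_or_ge n 0 with hn0 | hn0
  · exact H2.sub_mem (aeval_mulZ_mem_H2 _ g) (aeval_mulZ_mem_H2 _ h) n hn0
  have hnd : (ω.denom.natDegree : ℤ) ≤ n := by simpa [hn0] using hn
  obtain ⟨f, ρ, hρ, e, rfl⟩ := hy
  obtain ⟨t, htd, ht⟩ := hρ.exists_polynomial ω.denom_ne_zero
    (aeval mulZ ω.num (g : L2T) - aeval mulZ ω.denom f) (by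
      filter_upwards [e, aeval_mulZ_coeFn ω.num (g : L2T), aeval_mulZ_coeFn ω.denom f,
        circleEval_mul_denom ω, Lp.coeFn_sub (aeval mulZ ω.num (g : L2T)) (aeval mulZ ω.denom f)]
        with x h1 h2 h3 h4 h5
      rw [h5, Pi.sub_apply, h2, h3, ← h4]
      linear_combination ω.denom.eval (toCircle x : ℂ) * h1)
  have hsplit : clearDenom ω (g, rieszProj f) =
      aeval mulZ t (fourierBasis 0 : L2T) + aeval mulZ ω.denom (f - rieszProj f) := by
    rw [clearDenom_apply, ← ht, map_sub]
    abel
  rw [hsplit, fourierCoeff_eq_inner, inner_add_right, ← fourierCoeff_eq_inner,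
    ← fourierCoeff_eq_inner, fourierCoeff_aeval_mulZ, fourierCoeff_aeval_mulZ,
    Finset.sum_eq_zero, Finset.sum_eq_zero, add_zero]
  · intro k hk
    have hk' : 0 ≤ n - k := by
      have := Finset.mem_range.1 hk
      omega
    rw [fourierCoeff_eq_inner, inner_sub_right, ← fourierCoeff_eq_inner, ← fourierCoeff_eq_inner,
      fourierCoeff_rieszProj _ hk', sub_self, mul_zero]
  · intro k _
    rw [fourierCoeff_fourierBasis]
    split_ifs with hk
    · rw [coeff_eq_zero_of_degree_lt, zero_mul]
      refine htd.trans_le (degree_le_natDegree.trans ?_)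
      exact_mod_cast (by omega : ω.denom.natDegree ≤ k)
    · exact mul_zero _

theorem isClosed_toeplitzGraph (ω : RatFunc ℂ) : IsClosed (toeplitzGraph ω : Set (H2 × H2)) := by
  set Φ : H2 × H2 →ₗ[ℂ] L2T := (clearDenom ω : H2 × H2 →ₗ[ℂ] L2T)
  -- A subspace containing the kernel of `Φ` is the full preimage of its image.
  have h1 : ((toeplitzGraph ω).map Φ).comap Φ = toeplitzGraph ω := by
    rw [Submodule.comap_map_eq, sup_eq_left]
    exact ker_clearDenom_le ω
  set s := Finset.Ico (0 : ℤ) ω.denom.natDegree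
  have h2 : (toeplitzGraph ω).map Φ ≤
      Submodule.span ℂ ((fun n : ℤ => (fourierBasis n : L2T)) '' s) := by
    rintro _ ⟨y, hy, rfl⟩
    exact mem_span_fourierBasis s fun n hn => fourierCoeff_clearDenom hy hn
  have : FiniteDimensional ℂ
      (Submodule.span ℂ ((fun n : ℤ => (fourierBasis n : L2T)) '' s)) :=
    FiniteDimensional.span_of_finite ℂ (s.finite_toSet.image _)
  have : FiniteDimensional ℂ ((toeplitzGraph ω).map Φ) := Submodule.finiteDimensional_of_le h2
  rw [← h1]
  exact (Submodule.closed_of_finiteDimensional ((toeplitzGraph ω).map Φ)).preimage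
    (clearDenom ω).continuous

theorem mainTheorem11 (ω : RatFunc ℂ) : IsSarasonToeplitz (toeplitz ω) := by
  have hback (g : H2) (hg : shiftH2 g ∈ (toeplitz ω).domain) : g ∈ (toeplitz ω).domain := by
    obtain ⟨h, hh⟩ := mem_toeplitz_domain.1 hg
    exact mem_toeplitz_domain.2 (toeplitzGraph_of_shift hh)
  have hshift (g : H2) (hg : g ∈ (toeplitz ω).domain) : shiftH2 g ∈ (toeplitz ω).domain := by
    obtain ⟨h, hh⟩ := mem_toeplitz_domain.1 hg
    obtain ⟨h', hh', -⟩ := toeplitzGraph_shift hh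
    exact mem_toeplitz_domain.2 ⟨h', hh'⟩
  refine ⟨?_, dense_toeplitz_domain ω, hshift, ?_, ?_⟩
  · rw [LinearPMap.IsClosed, toeplitz_graph]
    exact isClosed_toeplitzGraph ω
  -- Equality of domains is the equivalence of `g ∈ Dom(T_ω)` and `S g ∈ Dom(T_ω)`.
  · refine LinearPMap.ext (le_antisymm hback hshift) fun g hf hg => ?_
    rw [LinearPMap.image_iff hg, toeplitz_graph]
    obtain ⟨h, hh⟩ := mem_toeplitz_domain.1 hg
    obtain ⟨h', hh', rfl⟩ := toeplitzGraph_shift hh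
    have hval : h' = toeplitz ω ⟨shiftH2 g, hshift g hg⟩ := by
      rw [LinearPMap.image_iff, toeplitz_graph]
      exact hh'
    rw [hval] at hh
    exact hh
  · intro f hf h0
    refine hback _ ?_
    rwa [shiftH2_adjoint_of_fourierCoeff_zero h0]
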